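/- For an integer $m$ and an integer $k$ let $p_{m,k}(x)=\binom{m}{k}x^k(1-x)^{m-k}$ if $0\le k\le m$, and $p_{m,k}(x)=0$ if $k<0$ or $k>m$. For $n\in\mathbb N$ put \begin{align*} \tilde b(x,n)&=\tfrac12 n^2x^4-(n^2+3n+16)x^3+\left(\tfrac12n^2+\tfrac{29}{6}n+\tfrac{89}{3}\right)x^2-\left(\tfrac{53}{3}+\tfrac{11}{6}n\right)x+\tfrac{10}{3},\\ \tilde d(x,n)&=-2n^2x^4+(4n^2+6n+32)x^3-\left(2n^2+\tfrac{28}{3}n+\tfrac{161}{3}\right)x^2+\left(\tfrac{80}{3}+\tfrac{10}{3}n\right)x-\tfrac{10}{3},\\ \tilde e(x,n)&=3n^2\,(x(1-x))^2, \end{align*} \begin{align*} p_{n,k}^{M,3}(x)={}&\tilde b(x,n)\,p_{n-4,k}(x)+\tilde d(x,n)\,p_{n-4,k-1}(x)+\tilde e(x,n)\,p_{n-4,k-2}(x)\\ &+\tilde d(1-x,n)\,p_{n-4,k-3}(x)+\tilde b(1-x,n)\,p_{n-4,k-4}(x), \end{align*} and, for $f$ continuous on $[0,1]$ and $x\in[0,1]$,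 $$\tilde D_n^{M,3}(f;x)=(n+1)\sum_{k=0}^n p_{n,k}^{M,3}(x)\int_0^1 p_{n,k}(t)f(t)\,dt .$$ Theorem. If $f\in C^{10}[0,1]$ (real-valued) and $x\in[0,1]$, then $$\tilde D_n^{M,3}(f;x)-f(x)=O\!\left(\frac1{n^3}\right)\qquad (n\to\infty),$$ that is, there are a constant $C$ and an index $N$ (which may depend on $f$ and $x$) such that $|\tilde D_n^{M,3}(f;x)-f(x)|\le C/n^3$ for all $n\ge N$. -/

import Mathlib

open Filter Asymptotics

noncomputable section

namespace DurrmeyerIII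

/-- The Bernstein basis `p_{m,k}(x) = C(m,k) x^k (1-x)^(m-k)` for `0 ≤ k ≤ m`, and `0` if `k < 0` or
`k > m`. Both indices are integers, so that `p_{n-4,k-j}` involves no truncated subtraction. -/
def p (m k : ℤ) (x : ℝ) : ℝ :=
  if 0 ≤ k ∧ k ≤ m then (bernsteinPolynomial ℝ m.toNat k.toNat).eval x else 0

/-- The weights `p_{n,k}^{M,3}(x)` built from coefficient functions `b(x,n)`, `d(x,n)`, `e(x,n)`. -/
def weight (b d e : ℝ → ℕ → ℝ) (n : ℕ) (k : ℤ) (x : ℝ) : ℝ :=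
  b x n * p ((n : ℤ) - 4) k x + d x n * p ((n : ℤ) - 4) (k - 1) x
    + e x n * p ((n : ℤ) - 4) (k - 2) x
    + d (1 - x) n * p ((n : ℤ) - 4) (k - 3) x + b (1 - x) n * p ((n : ℤ) - 4) (k - 4) x

/-- The operator `D_n^{M,3}(f;x) = (n+1) ∑_{k=0}^n p_{n,k}^{M,3}(x) ∫_0^1 p_{n,k}(t) f(t) dt`
with coefficient functions `b`, `d`, `e`. -/
def durrmeyer3 (b d e : ℝ → ℕ → ℝ) (n : ℕ) (f : ℝ → ℝ) (x : ℝ) : ℝ :=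
  ((n : ℝ) + 1) * ∑ k ∈ Finset.range (n + 1),
    weight b d e n (k : ℤ) x * ∫ t in (0 : ℝ)..1, p (n : ℤ) (k : ℤ) t * f t

/-- The function `b̃(x,n) = b̃₄(n) x⁴ + b̃₃(n) x³ + b̃₂(n) x² + b̃₁(n) x + b̃₀(n)`. -/
def bTilde (x : ℝ) (n : ℕ) : ℝ :=
  (1 / 2 * (n : ℝ) ^ 2) * x ^ 4
    + (-(n : ℝ) ^ 2 - 3 * (n : ℝ) - 16) * x ^ 3
    + (1 / 2 * (n : ℝ) ^ 2 + 29 / 6 * (n : ℝ) + 89 / 3) * x ^ 2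
    + (-(53 / 3) - 11 / 6 * (n : ℝ)) * x
    + 10 / 3

/-- The function `d̃(x,n) = d̃₄(n) x⁴ + d̃₃(n) x³ + d̃₂(n) x² + d̃₁(n) x + d̃₀(n)`. -/
def dTilde (x : ℝ) (n : ℕ) : ℝ :=
  (-2 * (n : ℝ) ^ 2) * x ^ 4
    + (4 * (n : ℝ) ^ 2 + 6 * (n : ℝ) + 32) * x ^ 3
    + (-2 * (n : ℝ) ^ 2 - 28 / 3 * (n : ℝ) - 161 / 3) * x ^ 2
    + (80 / 3 + 10 / 3 * (n : ℝ)) * x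
    + -(10 / 3)

/-- The function `ẽ(x,n) = ẽ₀(n) (x(1-x))²`. -/
def eTilde (x : ℝ) (n : ℕ) : ℝ :=
  (3 * (n : ℝ) ^ 2) * (x * (1 - x)) ^ 2

/-- The third-order operator `D̃_n^{M,3}`. -/
def durrmeyerTilde3 (n : ℕ) (f : ℝ → ℝ) (x : ℝ) : ℝ :=
  durrmeyer3 bTilde dTilde eTilde n f x

end DurrmeyerIII

end

/-!
The `s`-th central moment of the operator is `1 / ((n+2)⋯(n+s+1))` times a combination, with the
five coefficients of the weight, of polynomials `M_s(j)` depending on the shift `j = 0, …, 4`.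
These polynomials satisfy a recursion in `s`, from which the `r`-th forward difference of `M_s` in
`j` is `O(n^⌊(s-r)/2⌋)`. Summation against Newton's forward difference expansion brings in the
binomial moments `∑ⱼ cⱼ (j choose r)` of the coefficients. The individual coefficients are of order
`n²`, but their `r`-th binomial moment is only `O(n^⌊r/2⌋)`, so the `s`-th central moment is
`O(n^(⌊s/2⌋ - s))`. For `s ≥ 5` this is `O(n⁻³)`; the moments of order 1, 2, 3 vanish identically
and in the one of order 4 the quadratic term in `n` cancels. Hence the claim holds for polynomials.
The remainder after subtracting a Taylor polynomial is `O((t-x)¹⁰)`, and positivity of the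
Bernstein basis bounds its contribution by `n² · n⁻⁵`.
-/

namespace DurrmeyerIII

open Polynomial Topology MeasureTheory
open scoped fwdDiff

section BernsteinIdentities

variable {R : Type*} [CommRing R]

theorem X_mul_one_sub_X_mul_derivative_bernsteinPolynomial (m l : ℕ) :
    X * (1 - X) * derivative (bernsteinPolynomial R m l)
      = ((l : R[X]) - (m : R[X]) * X) * bernsteinPolynomial R m l := by
  rcases le_or_gt l m with h | h
  · obtain ⟨r, rfl⟩ := Nat.exists_eq_add_of_le h
    simp only [bernsteinPolynomial, Nat.add_sub_cancel_left]
    rcases l with _ | l <;> rcases r with _ | r <;>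
      simp [derivative_mul, derivative_pow] <;> ring
  · simp [bernsteinPolynomial.eq_zero_of_lt R h]

theorem sum_bernsteinPolynomial_mul_sub_mul (m : ℕ) (J : ℕ → R[X]) :
    ∑ l ∈ Finset.range (m + 1), bernsteinPolynomial R m l * (((l : R[X]) - (m : R[X]) * X) * J l)
      = X * (1 - X) * (derivative (∑ l ∈ Finset.range (m + 1), bernsteinPolynomial R m l * J l)
        - ∑ l ∈ Finset.range (m + 1), bernsteinPolynomial R m l * derivative (J l)) := by
  simp only [derivative_sum, derivative_mul, ← Finset.sum_sub_distrib, Finset.mul_sum]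
  refine Finset.sum_congr rfl fun l _ => ?_
  linear_combination (-J l) * X_mul_one_sub_X_mul_derivative_bernsteinPolynomial (R := R) m l

end BernsteinIdentities

theorem bernsteinPolynomial_eval_nonneg (n k : ℕ) {t : ℝ} (ht : t ∈ Set.Icc (0 : ℝ) 1) :
    0 ≤ (bernsteinPolynomial ℝ n k).eval t :=
  bernstein_nonneg (n := n) (ν := k) (x := ⟨t, ht⟩)

section KernelMoments

/-- The polynomial in `x` equal, up to the factor `(n+2)⋯(n+s+1)`, to
`(n+1) ∫₀¹ p_{n,k}(t) (t-x)^s dt`. It is defined by the recursion that integration by parts gives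
for these integrals, so that `n` and `k` may be real. -/
noncomputable def kernelMoment (n k : ℝ) : ℕ → ℝ[X]
  | 0 => 1
  | 1 => C k - C n * X + (1 - 2 * X)
  | s + 2 => (C k - C n * X + ((s : ℝ[X]) + 2) * (1 - 2 * X)) * kernelMoment n k (s + 1)
      + ((s : ℝ[X]) + 1) * (C n + (s : ℝ[X]) + 2) * (X * (1 - X)) * kernelMoment n k s

theorem derivative_kernelMoment_succ (n k : ℝ) (s : ℕ) :
    derivative (kernelMoment n k (s + 1))
      = -(((s : ℝ[X]) + 1) * (C n + (s : ℝ[X]) + 2) * kernelMoment n k s) := by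
  induction s using Nat.twoStepInduction with
  | zero =>
    simp only [kernelMoment, derivative_add, derivative_sub, derivative_mul, derivative_C,
      derivative_X, derivative_one, derivative_ofNat, Nat.cast_zero]
    ring
  | one =>
    simp only [kernelMoment, derivative_add, derivative_sub, derivative_mul, derivative_C,
      derivative_X, derivative_zero, derivative_one, derivative_ofNat, Nat.cast_zero, Nat.cast_one]
    ring
  | more s ih ih_succ =>
    rw [kernelMoment]
    simp only [derivative_mul, derivative_add, derivative_sub, derivative_C, derivative_X,
      derivative_natCast, derivative_one, derivative_ofNat]
    rw [ih_succ, show s + 1 + 1 = s + 2 from rfl, kernelMoment, ih]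
    push_cast
    ring

theorem integral_eval_derivative (P : ℝ[X]) (a b : ℝ) :
    ∫ t in a..b, (derivative P).eval t = P.eval b - P.eval a :=
  intervalIntegral.integral_eq_sub_of_hasDerivAt (fun t _ => P.hasDerivAt t)
    (derivative P).continuous.continuousOn.intervalIntegrable

theorem integral_bernsteinPolynomial {n k : ℕ} (h : k ≤ n) :
    ((n : ℝ) + 1) * ∫ t in (0 : ℝ)..1, (bernsteinPolynomial ℝ n k).eval t = 1 := by
  induction k with
  | zero =>
    have hderiv := integral_eval_derivative (bernsteinPolynomial ℝ (n + 1) 0) 0 1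
    rw [bernsteinPolynomial.derivative_zero] at hderiv
    simp only [bernsteinPolynomial.eval_at_0, bernsteinPolynomial.eval_at_1, eval_mul, eval_neg,
      eval_natCast, intervalIntegral.integral_const_mul, Nat.add_sub_cancel] at hderiv
    rw [if_neg (by lia), if_pos trivial] at hderiv
    push_cast at hderiv
    linarith
  | succ k ih =>
    have hint (i : ℕ) : IntervalIntegrable (fun t => (bernsteinPolynomial ℝ n i).eval t)
        volume 0 1 := (Polynomial.continuous _).intervalIntegrable _ _
    have hderiv := integral_eval_derivative (bernsteinPolynomial ℝ (n + 1) (k + 1)) 0 1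
    rw [bernsteinPolynomial.derivative_succ] at hderiv
    simp only [bernsteinPolynomial.eval_at_0, bernsteinPolynomial.eval_at_1, eval_mul, eval_sub,
      eval_natCast, intervalIntegral.integral_const_mul, Nat.add_sub_cancel] at hderiv
    rw [intervalIntegral.integral_sub (hint _) (hint _), if_neg (by lia), if_neg (by lia)] at hderiv
    push_cast at hderiv
    linarith [ih (by lia)]

theorem eval_derivative_bernsteinPolynomial_mul_pow (n k s : ℕ) (x t : ℝ) :
    (derivative (X * (1 - X) * bernsteinPolynomial ℝ n k * (X - C x) ^ s)).eval t
      = ((k : ℝ) - n * x + (s + 1) * (1 - 2 * x)) *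
          ((bernsteinPolynomial ℝ n k).eval t * (t - x) ^ s)
        + s * (x * (1 - x)) * ((bernsteinPolynomial ℝ n k).eval t * (t - x) ^ (s - 1))
        - ((n : ℝ) + 2 + s) * ((bernsteinPolynomial ℝ n k).eval t * (t - x) ^ (s + 1)) := by
  have hb := congrArg (eval t) (X_mul_one_sub_X_mul_derivative_bernsteinPolynomial (R := ℝ) n k)
  simp only [eval_mul, eval_sub, eval_X, eval_one, eval_natCast] at hb
  rcases s with _ | s
  · simp only [derivative_mul, derivative_sub, derivative_X, derivative_one, pow_zero, eval_add,
      eval_mul, eval_sub, eval_X, eval_one, eval_zero, Nat.cast_zero]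
    linear_combination hb
  · simp only [derivative_mul, derivative_sub, derivative_X, derivative_one,
      derivative_X_sub_C_pow, Nat.add_sub_cancel, eval_add, eval_mul, eval_sub, eval_pow, eval_X,
      eval_C, eval_one, eval_zero, Nat.cast_succ]
    linear_combination (t - x) ^ (s + 1) * hb

theorem integral_bernsteinPolynomial_mul_pow_succ (n k s : ℕ) (x : ℝ) :
    ((n : ℝ) + 2 + s) * ∫ t in (0 : ℝ)..1, (bernsteinPolynomial ℝ n k).eval t * (t - x) ^ (s + 1)
      = ((k : ℝ) - n * x + (s + 1) * (1 - 2 * x)) *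
          (∫ t in (0 : ℝ)..1, (bernsteinPolynomial ℝ n k).eval t * (t - x) ^ s)
        + s * (x * (1 - x)) *
          ∫ t in (0 : ℝ)..1, (bernsteinPolynomial ℝ n k).eval t * (t - x) ^ (s - 1) := by
  have hint (i : ℕ) (c : ℝ) : IntervalIntegrable
      (fun t : ℝ => c * ((bernsteinPolynomial ℝ n k).eval t * (t - x) ^ i)) volume 0 1 :=
    Continuous.intervalIntegrable (by fun_prop) _ _
  have hparts :=
    integral_eval_derivative (X * (1 - X) * bernsteinPolynomial ℝ n k * (X - C x) ^ s) 0 1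
  simp only [eval_derivative_bernsteinPolynomial_mul_pow] at hparts
  rw [intervalIntegral.integral_sub ((hint _ _).add (hint _ _)) (hint _ _),
    intervalIntegral.integral_add (hint _ _) (hint _ _)] at hparts
  simp only [intervalIntegral.integral_const_mul, eval_mul, eval_sub, eval_X, eval_one, sub_self,
    mul_zero, zero_mul] at hparts
  linarith

theorem integral_bernsteinPolynomial_mul_pow {n k : ℕ} (hk : k ≤ n) (s : ℕ) (x : ℝ) :
    ((n + 2).ascFactorial s : ℝ) * (((n : ℝ) + 1) *
      ∫ t in (0 : ℝ)..1, (bernsteinPolynomial ℝ n k).eval t * (t - x) ^ s)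
      = (kernelMoment n k s).eval x := by
  induction s using Nat.twoStepInduction with
  | zero => simpa [kernelMoment] using integral_bernsteinPolynomial hk
  | one =>
    have hrec := integral_bernsteinPolynomial_mul_pow_succ n k 0 x
    have hzero := integral_bernsteinPolynomial hk
    simp only [kernelMoment, Nat.ascFactorial_succ, Nat.ascFactorial_zero, eval_add, eval_mul,
      eval_sub, eval_C, eval_X, eval_ofNat, eval_one, pow_zero, mul_one] at hrec ⊢
    push_cast at hrec ⊢
    linear_combination ((n : ℝ) + 1) * hrec + ((k : ℝ) - n * x + (1 - 2 * x)) * hzero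
  | more s ih ih_succ =>
    have hrec := integral_bernsteinPolynomial_mul_pow_succ n k (s + 1) x
    simp only [kernelMoment, eval_add, eval_mul, eval_sub, eval_C, eval_X, eval_natCast,
      eval_ofNat, eval_one, ← ih, ← ih_succ]
    simp only [Nat.ascFactorial_succ, Nat.add_sub_cancel] at hrec ⊢
    push_cast at hrec ⊢
    linear_combination ((n : ℝ) + 1) * ((n + 2).ascFactorial s : ℝ) * ((n : ℝ) + 2 + s) * hrec

end KernelMoments

section ShiftedOperators

/-- The polynomial in `x` equal, up to the factor `(n+2)⋯(n+s+1)`, to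
`(n+1) ∑ l, p_{n-q,l}(x) ∫₀¹ p_{n,l+j}(t) (t-x)^s dt`; these are the central moments of
`shiftedDurrmeyer`. -/
noncomputable def shiftedMoment (n : ℝ) (q j : ℕ) : ℕ → ℝ[X]
  | 0 => 1
  | 1 => (j : ℝ[X]) - (q : ℝ[X]) * X + (1 - 2 * X)
  | s + 2 => X * (1 - X) * derivative (shiftedMoment n q j (s + 1))
      + ((j : ℝ[X]) - (q : ℝ[X]) * X + ((s : ℝ[X]) + 2) * (1 - 2 * X)) * shiftedMoment n q j (s + 1)
      + 2 * ((s : ℝ[X]) + 1) * (C n + (s : ℝ[X]) + 2) * (X * (1 - X)) * shiftedMoment n q j s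

theorem sum_bernsteinPolynomial_mul_add_mul (m q j : ℕ) (A : ℝ[X]) (J : ℕ → ℝ[X]) :
    ∑ l ∈ Finset.range (m + 1), bernsteinPolynomial ℝ m l *
        ((C ((l : ℝ) + j) - C ((m : ℝ) + q) * X + A) * J l)
      = X * (1 - X) * (derivative (∑ l ∈ Finset.range (m + 1), bernsteinPolynomial ℝ m l * J l)
          - ∑ l ∈ Finset.range (m + 1), bernsteinPolynomial ℝ m l * derivative (J l))
        + ((j : ℝ[X]) - (q : ℝ[X]) * X + A) *
          ∑ l ∈ Finset.range (m + 1), bernsteinPolynomial ℝ m l * J l := by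
  rw [← sum_bernsteinPolynomial_mul_sub_mul, Finset.mul_sum, ← Finset.sum_add_distrib]
  refine Finset.sum_congr rfl fun l _ => ?_
  simp only [C_add, C_eq_natCast]
  ring

theorem sum_bernsteinPolynomial_mul_kernelMoment (m q j s : ℕ) :
    ∑ l ∈ Finset.range (m + 1),
      bernsteinPolynomial ℝ m l * kernelMoment ((m : ℝ) + q) ((l : ℝ) + j) s
      = shiftedMoment ((m : ℝ) + q) q j s := by
  induction s using Nat.twoStepInduction with
  | zero => simp [kernelMoment, shiftedMoment, bernsteinPolynomial.sum]
  | one =>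
    have h := sum_bernsteinPolynomial_mul_add_mul m q j (1 - 2 * X) (fun _ => 1)
    simpa only [kernelMoment, shiftedMoment, mul_one, bernsteinPolynomial.sum, derivative_one,
      mul_zero, Finset.sum_const_zero, sub_self, zero_add] using h
  | more s ih ih_succ =>
    simp only [kernelMoment, shiftedMoment, mul_add (bernsteinPolynomial ℝ m _),
      Finset.sum_add_distrib, sum_bernsteinPolynomial_mul_add_mul, ih_succ]
    simp only [derivative_kernelMoment_succ, mul_neg, Finset.sum_neg_distrib,
      mul_left_comm (bernsteinPolynomial ℝ m _), ← Finset.mul_sum, ih]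
    ring

/-- The Bernstein–Durrmeyer type operator whose outer Bernstein basis has degree `m`, whose inner
one has degree `m + q`, and which pairs the outer index `l` with the inner index `l + j`. -/
noncomputable def shiftedDurrmeyer (m q j : ℕ) (g : ℝ → ℝ) (x : ℝ) : ℝ :=
  ((m : ℝ) + q + 1) * ∑ l ∈ Finset.range (m + 1), (bernsteinPolynomial ℝ m l).eval x *
    ∫ t in (0 : ℝ)..1, (bernsteinPolynomial ℝ (m + q) (l + j)).eval t * g t

theorem ascFactorial_mul_shiftedDurrmeyer_pow (m s : ℕ) {q j : ℕ} (hj : j ≤ q) (x : ℝ) :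
    ((m + q + 2).ascFactorial s : ℝ) * shiftedDurrmeyer m q j (fun t => (t - x) ^ s) x
      = (shiftedMoment ((m : ℝ) + q) q j s).eval x := by
  rw [← sum_bernsteinPolynomial_mul_kernelMoment, eval_finsetSum, shiftedDurrmeyer, ← mul_assoc,
    Finset.mul_sum]
  refine Finset.sum_congr rfl fun l hl => ?_
  have hlj : l + j ≤ m + q := by have := Finset.mem_range.mp hl; lia
  have hmoment := integral_bernsteinPolynomial_mul_pow hlj s x
  push_cast at hmoment
  rw [eval_mul, ← hmoment]
  ring

theorem abs_shiftedDurrmeyer_le (m q j : ℕ) {x : ℝ} (hx : x ∈ Set.Icc (0 : ℝ) 1) {g h : ℝ → ℝ}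
    {K : ℝ} (hh : IntervalIntegrable h volume 0 1)
    (hgh : ∀ t ∈ Set.Icc (0 : ℝ) 1, |g t| ≤ K * h t) :
    |shiftedDurrmeyer m q j g x| ≤ K * shiftedDurrmeyer m q j h x := by
  have hB {n k : ℕ} {t : ℝ} (ht : t ∈ Set.Icc (0 : ℝ) 1) := bernsteinPolynomial_eval_nonneg n k ht
  have hintegral (n k : ℕ) : |∫ t in (0 : ℝ)..1, (bernsteinPolynomial ℝ n k).eval t * g t|
      ≤ K * ∫ t in (0 : ℝ)..1, (bernsteinPolynomial ℝ n k).eval t * h t := by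
    rw [← intervalIntegral.integral_const_mul, ← Real.norm_eq_abs]
    refine intervalIntegral.norm_integral_le_of_norm_le zero_le_one (.of_forall fun t ht => ?_)
      ((hh.continuousOn_mul (Polynomial.continuous _).continuousOn).const_mul K)
    have ht' := Set.Ioc_subset_Icc_self ht
    rw [Real.norm_eq_abs, abs_mul, abs_of_nonneg (hB ht'), mul_left_comm]
    exact mul_le_mul_of_nonneg_left (hgh t ht') (hB ht')
  rw [shiftedDurrmeyer, shiftedDurrmeyer, abs_mul, abs_of_nonneg (by positivity), mul_left_comm,
    Finset.mul_sum]
  refine mul_le_mul_of_nonneg_left ((Finset.abs_sum_le_sum_abs _ _).trans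
    (Finset.sum_le_sum fun l _ => ?_)) (by positivity)
  rw [abs_mul, abs_of_nonneg (hB hx), mul_left_comm]
  exact mul_le_mul_of_nonneg_left (hintegral _ _) (hB hx)

end ShiftedOperators

section Asymptotics

theorem isBigO_natCast_zpow_mul {a b : ℕ → ℝ} {d e : ℤ} (ha : a =O[atTop] fun n => (n : ℝ) ^ d)
    (hb : b =O[atTop] fun n => (n : ℝ) ^ e) :
    (fun n => a n * b n) =O[atTop] fun n => (n : ℝ) ^ (d + e) := by
  refine (ha.mul hb).congr' .rfl ?_
  filter_upwards [eventually_ne_atTop 0] with n hn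
  rw [zpow_add₀ (Nat.cast_ne_zero.mpr hn)]

theorem isBigO_eval_natCast {P : ℝ[X]} {d : ℕ} (hP : P.degree ≤ d) :
    (fun n : ℕ => P.eval (n : ℝ)) =O[atTop] fun n => (n : ℝ) ^ (d : ℤ) := by
  have h := Polynomial.isBigO_atTop_of_degree_le P (X ^ d) (by simpa using hP)
  simpa [Function.comp_def] using h.comp_tendsto tendsto_natCast_atTop_atTop

theorem isBigO_const_natCast_zpow (c : ℝ) {d : ℤ} (hd : 0 ≤ d) :
    (fun _ : ℕ => c) =O[atTop] fun n => (n : ℝ) ^ d := by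
  lift d to ℕ using hd
  simpa using isBigO_eval_natCast (P := C c) (degree_C_le.trans (by exact_mod_cast d.zero_le))

theorem isBigO_linear (u v : ℝ) :
    (fun n : ℕ => u * (n : ℝ) + v) =O[atTop] fun n => (n : ℝ) ^ (1 : ℤ) := by
  simpa using isBigO_eval_natCast (d := 1) (degree_linear_le (a := u) (b := v))

theorem isBigO_quadratic (u v w : ℝ) :
    (fun n : ℕ => u * (n : ℝ) ^ 2 + v * n + w) =O[atTop] fun n => (n : ℝ) ^ (2 : ℤ) := by
  simpa using isBigO_eval_natCast (d := 2) (degree_quadratic_le (a := u) (b := v) (c := w))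

/-- All derivatives of the polynomials `F n`, including the zeroth, are pointwise `O(n^d)`. Unlike
a pointwise bound on `F n` alone, this notion is stable under differentiation. -/
def PolyGrowth (d : ℤ) (F : ℕ → ℝ[X]) : Prop :=
  ∀ (k : ℕ) (x : ℝ), (fun n => (derivative^[k] (F n)).eval x) =O[atTop] fun n => (n : ℝ) ^ d

namespace PolyGrowth

variable {d e : ℤ} {F G : ℕ → ℝ[X]}

theorem eval (h : PolyGrowth d F) (x : ℝ) :
    (fun n => (F n).eval x) =O[atTop] fun n => (n : ℝ) ^ d := h 0 x

theorem zero (d : ℤ) : PolyGrowth d (fun _ => 0) := fun k x => by simp [isBigO_zero]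

theorem const (P : ℝ[X]) (hd : 0 ≤ d) : PolyGrowth d (fun _ => P) := fun _ _ =>
  isBigO_const_natCast_zpow _ hd

theorem add (hF : PolyGrowth d F) (hG : PolyGrowth d G) : PolyGrowth d (fun n => F n + G n) :=
  fun k x => by simpa only [iterate_map_add, eval_add] using (hF k x).add (hG k x)

theorem derivative (hF : PolyGrowth d F) : PolyGrowth d (fun n => Polynomial.derivative (F n)) :=
  fun k x => by simpa only [← Function.iterate_succ_apply] using hF (k + 1) x

theorem const_mul (P : ℝ[X]) (hF : PolyGrowth d F) : PolyGrowth d (fun n => P * F n) :=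
  fun k x => by
    simp only [iterate_derivative_mul, eval_finsetSum, eval_mul, nsmul_eq_mul]
    exact IsBigO.fun_sum fun i _ => ((hF i x).const_mul_left _).const_mul_left _

theorem C_mul {g : ℕ → ℝ} (hg : g =O[atTop] fun n => (n : ℝ) ^ d) (hF : PolyGrowth e F) :
    PolyGrowth (d + e) (fun n => C (g n) * F n) := fun k x => by
  simpa only [iterate_derivative_C_mul, eval_mul, eval_C] using isBigO_natCast_zpow_mul hg (hF k x)

end PolyGrowth

end Asymptotics

section ForwardDifferences

theorem fwdDiff_iter_zero {M G : Type*} [AddCommMonoid M] [AddCommGroup G] (h : M) (r : ℕ) :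
    Δ_[h] ^[r] (fun _ : M => (0 : G)) = fun _ => 0 :=
  Function.iterate_fixed (fwdDiff_const h 0) r

theorem fwdDiff_iter_shiftedMoment_add_two (n : ℝ) (q r j s : ℕ) :
    Δ_[1] ^[r] (fun j => shiftedMoment n q j (s + 2)) j
      = X * (1 - X) * derivative (Δ_[1] ^[r] (fun j => shiftedMoment n q j (s + 1)) j)
        + ((j : ℝ[X]) - (q : ℝ[X]) * X + ((s : ℝ[X]) + 2) * (1 - 2 * X)) *
          Δ_[1] ^[r] (fun j => shiftedMoment n q j (s + 1)) j
        + (r : ℝ[X]) * Δ_[1] ^[r - 1] (fun j => shiftedMoment n q j (s + 1)) (j + 1)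
        + 2 * ((s : ℝ[X]) + 1) * (C n + (s : ℝ[X]) + 2) * (X * (1 - X)) *
          Δ_[1] ^[r] (fun j => shiftedMoment n q j s) j := by
  induction r generalizing j with
  | zero => simp [shiftedMoment]
  | succ r ih =>
    have hdiff : (r : ℝ[X]) * (Δ_[1] ^[r - 1] (fun j => shiftedMoment n q j (s + 1)) (j + 2)
          - Δ_[1] ^[r - 1] (fun j => shiftedMoment n q j (s + 1)) (j + 1))
        = r * Δ_[1] ^[r] (fun j => shiftedMoment n q j (s + 1)) (j + 1) := by
      rcases r with _ | r
      · simp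
      · rw [Function.iterate_succ_apply', Nat.add_sub_cancel, fwdDiff]
    simp only [Function.iterate_succ_apply', fwdDiff, ih, derivative_sub,
      Nat.add_sub_cancel] at hdiff ⊢
    push_cast
    linear_combination hdiff

theorem fwdDiff_shiftedMoment_zero (n : ℝ) (q : ℕ) :
    Δ_[1] (fun j => shiftedMoment n q j 0) = fun _ => 0 := by
  funext j
  simp [fwdDiff, shiftedMoment]

theorem fwdDiff_shiftedMoment_one (n : ℝ) (q : ℕ) :
    Δ_[1] (fun j => shiftedMoment n q j 1) = fun _ => 1 := by
  funext j
  simp [fwdDiff, shiftedMoment]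

theorem polyGrowth_fwdDiff_iter_shiftedMoment (q : ℕ) {s r : ℕ} {d : ℤ}
    (h : (s : ℤ) ≤ r + 2 * d + 1) (j : ℕ) :
    PolyGrowth d (fun n : ℕ => Δ_[1] ^[r] (fun j => shiftedMoment n q j s) j) := by
  induction s using Nat.twoStepInduction generalizing r d j with
  | zero =>
    rcases r with _ | r
    · exact .const _ (by lia)
    · simpa only [Function.iterate_succ_apply, fwdDiff_shiftedMoment_zero,
        fwdDiff_iter_zero] using PolyGrowth.zero d
  | one =>
    rcases r with _ | _ | r
    · exact .const _ (by lia)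
    · simpa [fwdDiff_shiftedMoment_one] using PolyGrowth.const 1 (by lia)
    · simpa only [Function.iterate_succ_apply, fwdDiff_shiftedMoment_one, fwdDiff_const,
        fwdDiff_iter_zero] using PolyGrowth.zero d
  | more s ih ih_succ =>
    simp only [fwdDiff_iter_shiftedMoment_add_two]
    have hsame := ih_succ (r := r) (d := d) (by lia) j
    have hlower : PolyGrowth d (fun n : ℕ =>
        (r : ℝ[X]) * Δ_[1] ^[r - 1] (fun j => shiftedMoment n q j (s + 1)) (j + 1)) := by
      rcases r with _ | r
      · simpa using PolyGrowth.zero d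
      · exact (ih_succ (by lia) (j + 1)).const_mul _
    have hpred := ((ih (r := r) (d := d - 1) (by lia) j).C_mul
      (isBigO_linear 1 ((s : ℝ) + 2))).const_mul (2 * ((s : ℝ[X]) + 1) * (X * (1 - X)))
    rw [add_sub_cancel] at hpred
    refine (((hsame.derivative.const_mul _).add (hsame.const_mul _)).add hlower).add ?_
    convert hpred using 2 with n
    simp only [one_mul, C_add, C_eq_natCast, C_ofNat]
    ring

/-- The `r`-th binomial moment `∑ⱼ cⱼ (j choose r)` of a finite sequence. -/
def binomialMoment {R : Type*} [Semiring R] {N : ℕ} (c : Fin N → R) (r : ℕ) : R :=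
  ∑ j, c j * (j.val.choose r : R)

theorem sum_smul_eq_sum_binomialMoment_smul_fwdDiff_iter {R M : Type*} [Ring R] [AddCommGroup M]
    [Module R M] {N : ℕ} (c : Fin N → R) (f : ℕ → M) :
    ∑ j, c j • f j = ∑ r ∈ Finset.range N, binomialMoment c r • Δ_[1] ^[r] f 0 := by
  have hnewton (j : Fin N) :
      f j = ∑ r ∈ Finset.range N, (j.val.choose r : R) • Δ_[1] ^[r] f 0 := by
    have h := shift_eq_sum_fwdDiff_iter 1 f j 0
    simp only [zero_add, smul_eq_mul, mul_one] at h
    simp only [Nat.cast_smul_eq_nsmul, h]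
    refine Finset.sum_subset (Finset.range_subset_range.mpr j.isLt) fun r _ hr => ?_
    rw [Nat.choose_eq_zero_of_lt (by simpa using hr), zero_smul]
  simp only [binomialMoment, Finset.sum_smul, mul_smul]
  rw [Finset.sum_comm]
  exact Finset.sum_congr rfl fun j _ => by rw [← Finset.smul_sum, ← hnewton]

theorem isBigO_sum_mul_shiftedMoment {N : ℕ} {c : ℕ → Fin N → ℝ}
    (hc : ∀ r < N, (fun n => binomialMoment (c n) r) =O[atTop] fun n => (n : ℝ) ^ ((r / 2 : ℕ) : ℤ))
    (q : ℕ) {s : ℕ} {d : ℤ} (hs : (s : ℤ) ≤ 2 * d + 1) (x : ℝ) :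
    (fun n : ℕ => ∑ j, c n j * (shiftedMoment n q j s).eval x) =O[atTop] fun n => (n : ℝ) ^ d := by
  have hnewton (n : ℕ) : ∑ j, c n j * (shiftedMoment n q j s).eval x
      = ∑ r ∈ Finset.range N, binomialMoment (c n) r *
        (Δ_[1] ^[r] (fun j => shiftedMoment n q j s) 0).eval x := by
    simpa [eval_finsetSum] using congrArg (eval x)
      (sum_smul_eq_sum_binomialMoment_smul_fwdDiff_iter (c n) fun j => shiftedMoment n q j s)
  simp only [hnewton]
  refine IsBigO.fun_sum fun r hr => ?_
  have hdiff := (polyGrowth_fwdDiff_iter_shiftedMoment q (s := s) (r := r)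
    (d := d - (r / 2 : ℕ)) (by lia) 0).eval x
  simpa only [add_sub_cancel] using isBigO_natCast_zpow_mul (hc r (Finset.mem_range.mp hr)) hdiff

end ForwardDifferences

section ShiftedOperatorGrowth

theorem isBigO_inv_ascFactorial (a s : ℕ) :
    (fun n : ℕ => ((n + a).ascFactorial s : ℝ)⁻¹) =O[atTop] fun n => (n : ℝ) ^ (-(s : ℤ)) := by
  refine IsBigO.of_bound 1 ?_
  filter_upwards [eventually_ge_atTop 1] with n hn
  rw [one_mul, zpow_neg, zpow_natCast, norm_inv, norm_inv, Real.norm_natCast, norm_pow,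
    Real.norm_natCast]
  refine inv_anti₀ (by positivity) ?_
  exact_mod_cast (Nat.pow_le_pow_left (by lia) s).trans (Nat.pow_succ_le_ascFactorial (n + a) s)

theorem shiftedDurrmeyer_pow {n q j : ℕ} (hn : q ≤ n) (s : ℕ) (hj : j ≤ q) (x : ℝ) :
    shiftedDurrmeyer (n - q) q j (fun t => (t - x) ^ s) x
      = ((n + 2).ascFactorial s : ℝ)⁻¹ * (shiftedMoment n q j s).eval x := by
  obtain ⟨m, rfl⟩ := Nat.exists_eq_add_of_le' hn
  rw [eq_inv_mul_iff_mul_eq₀ (by exact_mod_cast (Nat.ascFactorial_pos _ _).ne'),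
    Nat.add_sub_cancel, ascFactorial_mul_shiftedDurrmeyer_pow m s hj, Nat.cast_add]

theorem isBigO_shiftedDurrmeyer_of_abs_le {q j : ℕ} (hj : j ≤ q) {x : ℝ}
    (hx : x ∈ Set.Icc (0 : ℝ) 1) {R : ℝ → ℝ} {K : ℝ} {i : ℕ}
    (hR : ∀ t ∈ Set.Icc (0 : ℝ) 1, |R t| ≤ K * (t - x) ^ (2 * i)) :
    (fun n => shiftedDurrmeyer (n - q) q j R x) =O[atTop] fun n => (n : ℝ) ^ (-(i : ℤ)) := by
  have hmoment := isBigO_natCast_zpow_mul (isBigO_inv_ascFactorial 2 (2 * i))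
    ((polyGrowth_fwdDiff_iter_shiftedMoment q (s := 2 * i) (r := 0) (d := i) (by lia) j).eval x)
  rw [show -((2 * i : ℕ) : ℤ) + i = -i by push_cast; ring] at hmoment
  refine IsBigO.trans (IsBigO.of_bound |K| ?_) hmoment
  filter_upwards [eventually_ge_atTop q] with n hn
  have hbound := abs_shiftedDurrmeyer_le (n - q) q j hx (Continuous.intervalIntegrable
    (by fun_prop) _ _) hR
  rw [shiftedDurrmeyer_pow hn _ hj] at hbound
  rw [Real.norm_eq_abs, Real.norm_eq_abs, ← abs_mul]
  exact hbound.trans (le_abs_self _)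

end ShiftedOperatorGrowth

section Weights

/-- The five coefficients `b(x,n), d(x,n), e(x,n), d(1-x,n), b(1-x,n)` in the weights, indexed by
the shift of the Bernstein basis function that they multiply. -/
noncomputable def weightCoeff (b d e : ℝ → ℕ → ℝ) (n : ℕ) (x : ℝ) : Fin 5 → ℝ :=
  ![b x n, d x n, e x n, d (1 - x) n, b (1 - x) n]

variable (b d e : ℝ → ℕ → ℝ)

theorem weight_eq_sum (n : ℕ) (k : ℤ) (x : ℝ) :
    weight b d e n k x = ∑ j : Fin 5, weightCoeff b d e n x j * p ((n : ℤ) - 4) (k - j.val) x := by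
  simp [weight, weightCoeff, Fin.sum_univ_five]

theorem p_natCast (m k : ℕ) (x : ℝ) :
    p (m : ℤ) (k : ℤ) x = (bernsteinPolynomial ℝ m k).eval x := by
  rw [p]
  split_ifs with h
  · simp only [Int.toNat_natCast]
  · rw [bernsteinPolynomial.eq_zero_of_lt ℝ (by lia : m < k), eval_zero]

theorem sum_p_sub_mul (m : ℕ) {q j : ℕ} (hj : j ≤ q) (x : ℝ) (v : ℕ → ℝ) :
    ∑ k ∈ Finset.range (m + q + 1), p (m : ℤ) ((k : ℤ) - j) x * v k
      = ∑ l ∈ Finset.range (m + 1), (bernsteinPolynomial ℝ m l).eval x * v (l + j) := by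
  rw [show m + q + 1 = j + ((m + 1) + (q - j)) by lia, Finset.sum_range_add, Finset.sum_range_add,
    Finset.sum_eq_zero, Finset.sum_eq_zero (s := Finset.range (q - j)), zero_add, add_zero]
  · refine Finset.sum_congr rfl fun l _ => ?_
    rw [show (((j + l : ℕ) : ℤ) - j) = (l : ℤ) by push_cast; ring, p_natCast, add_comm j l]
  · intro l _
    rw [p, if_neg (by lia), zero_mul]
  · intro l hl
    have := Finset.mem_range.mp hl
    rw [p, if_neg (by lia), zero_mul]

theorem shiftedDurrmeyer_eq_sum_p (m : ℕ) {q j : ℕ} (hj : j ≤ q) (f : ℝ → ℝ) (x : ℝ) :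
    shiftedDurrmeyer m q j f x = ((m : ℝ) + q + 1) * ∑ k ∈ Finset.range (m + q + 1),
      p (m : ℤ) ((k : ℤ) - j) x * ∫ t in (0 : ℝ)..1, p ((m + q : ℕ) : ℤ) (k : ℤ) t * f t := by
  rw [sum_p_sub_mul m hj, shiftedDurrmeyer]
  simp only [p_natCast]

theorem durrmeyer3_eq_sum {n : ℕ} (hn : 4 ≤ n) (f : ℝ → ℝ) (x : ℝ) :
    durrmeyer3 b d e n f x
      = ∑ j : Fin 5, weightCoeff b d e n x j * shiftedDurrmeyer (n - 4) 4 j f x := by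
  obtain ⟨m, rfl⟩ := Nat.exists_eq_add_of_le' hn
  have hm : ((m + 4 : ℕ) : ℤ) - 4 = m := by push_cast; ring
  simp only [durrmeyer3, weight_eq_sum, hm, Nat.add_sub_cancel,
    shiftedDurrmeyer_eq_sum_p m (Nat.le_of_lt_succ (Fin.is_lt _)), Finset.mul_sum, Finset.sum_mul]
  rw [Finset.sum_comm]
  refine Finset.sum_congr rfl fun j _ => Finset.sum_congr rfl fun k _ => ?_
  push_cast
  ring

theorem intervalIntegrable_p_mul (n k : ℕ) {f : ℝ → ℝ} (hf : IntervalIntegrable f volume 0 1) :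
    IntervalIntegrable (fun t => p (n : ℤ) (k : ℤ) t * f t) volume 0 1 := by
  simp only [p_natCast]
  exact hf.continuousOn_mul (Polynomial.continuous _).continuousOn

theorem durrmeyer3_sub (n : ℕ) {f g : ℝ → ℝ} (hf : IntervalIntegrable f volume 0 1)
    (hg : IntervalIntegrable g volume 0 1) (x : ℝ) :
    durrmeyer3 b d e n (fun t => f t - g t) x
      = durrmeyer3 b d e n f x - durrmeyer3 b d e n g x := by
  simp only [durrmeyer3, mul_sub, Finset.sum_sub_distrib, intervalIntegral.integral_sub
    (intervalIntegrable_p_mul n _ hf) (intervalIntegrable_p_mul n _ hg)]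

theorem durrmeyer3_sum_mul {ι : Type*} (n : ℕ) (S : Finset ι) (a : ι → ℝ) {g : ι → ℝ → ℝ}
    (hg : ∀ i ∈ S, IntervalIntegrable (g i) volume 0 1) (x : ℝ) :
    durrmeyer3 b d e n (fun t => ∑ i ∈ S, a i * g i t) x
      = ∑ i ∈ S, a i * durrmeyer3 b d e n (g i) x := by
  have hintegral (k : ℕ) : ∫ t in (0 : ℝ)..1, p (n : ℤ) (k : ℤ) t * ∑ i ∈ S, a i * g i t
      = ∑ i ∈ S, a i * ∫ t in (0 : ℝ)..1, p (n : ℤ) (k : ℤ) t * g i t := by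
    simp only [Finset.mul_sum, mul_left_comm _ (a _)]
    rw [intervalIntegral.integral_finsetSum fun i hi =>
      (intervalIntegrable_p_mul n k (hg i hi)).const_mul (a i)]
    simp only [intervalIntegral.integral_const_mul]
  simp only [durrmeyer3, hintegral]
  simp only [Finset.mul_sum, mul_left_comm _ (a _)]
  exact Finset.sum_comm

theorem durrmeyer3_pow {n : ℕ} (hn : 4 ≤ n) (s : ℕ) (x : ℝ) :
    durrmeyer3 b d e n (fun t => (t - x) ^ s) x
      = ((n + 2).ascFactorial s : ℝ)⁻¹ *
        ∑ j : Fin 5, weightCoeff b d e n x j * (shiftedMoment n 4 j s).eval x := by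
  rw [durrmeyer3_eq_sum b d e hn, Finset.mul_sum]
  refine Finset.sum_congr rfl fun j _ => ?_
  rw [shiftedDurrmeyer_pow hn s (Nat.le_of_lt_succ j.is_lt), mul_left_comm]

theorem isBigO_durrmeyer3_of_abs_le {x : ℝ} (hx : x ∈ Set.Icc (0 : ℝ) 1) {c : ℤ}
    (hcoeff : ∀ j, (fun n => weightCoeff b d e n x j) =O[atTop] fun n => (n : ℝ) ^ c)
    {R : ℝ → ℝ} {K : ℝ} {i : ℕ} (hR : ∀ t ∈ Set.Icc (0 : ℝ) 1, |R t| ≤ K * (t - x) ^ (2 * i)) :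
    (fun n => durrmeyer3 b d e n R x) =O[atTop] fun n => (n : ℝ) ^ (c - i) := by
  have hterm (j : Fin 5) := isBigO_natCast_zpow_mul (hcoeff j)
    (isBigO_shiftedDurrmeyer_of_abs_le (Nat.le_of_lt_succ j.is_lt) hx hR)
  simp only [← sub_eq_add_neg] at hterm
  refine (IsBigO.fun_sum fun j (_ : j ∈ Finset.univ) => hterm j).congr' ?_ .rfl
  filter_upwards [eventually_ge_atTop 4] with n hn
  rw [durrmeyer3_eq_sum b d e hn]

end Weights

section TildeCoefficients

theorem isBigO_bTilde (x : ℝ) :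
    (fun n : ℕ => bTilde x n) =O[atTop] fun n => (n : ℝ) ^ (2 : ℤ) :=
  (isBigO_quadratic (1 / 2 * x ^ 4 - x ^ 3 + 1 / 2 * x ^ 2)
    (-3 * x ^ 3 + 29 / 6 * x ^ 2 - 11 / 6 * x)
    (-16 * x ^ 3 + 89 / 3 * x ^ 2 - 53 / 3 * x + 10 / 3)).congr_left fun n => by
      rw [bTilde]; ring

theorem isBigO_dTilde (x : ℝ) :
    (fun n : ℕ => dTilde x n) =O[atTop] fun n => (n : ℝ) ^ (2 : ℤ) :=
  (isBigO_quadratic (-2 * x ^ 4 + 4 * x ^ 3 - 2 * x ^ 2)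
    (6 * x ^ 3 - 28 / 3 * x ^ 2 + 10 / 3 * x)
    (32 * x ^ 3 - 161 / 3 * x ^ 2 + 80 / 3 * x - 10 / 3)).congr_left fun n => by
      rw [dTilde]; ring

theorem isBigO_eTilde (x : ℝ) :
    (fun n : ℕ => eTilde x n) =O[atTop] fun n => (n : ℝ) ^ (2 : ℤ) :=
  (isBigO_quadratic (3 * (x * (1 - x)) ^ 2) 0 0).congr_left fun n => by
      rw [eTilde]; ring

theorem isBigO_weightCoeff_tilde (x : ℝ) (j : Fin 5) :
    (fun n => weightCoeff bTilde dTilde eTilde n x j) =O[atTop] fun n => (n : ℝ) ^ (2 : ℤ) := by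
  fin_cases j
  · exact isBigO_bTilde x
  · exact isBigO_dTilde x
  · exact isBigO_eTilde x
  · exact isBigO_dTilde (1 - x)
  · exact isBigO_bTilde (1 - x)

theorem isBigO_binomialMoment_weightCoeff_tilde (x : ℝ) {r : ℕ} (hr : r < 5) :
    (fun n => binomialMoment (weightCoeff bTilde dTilde eTilde n x) r)
      =O[atTop] fun n => (n : ℝ) ^ ((r / 2 : ℕ) : ℤ) := by
  simp only [binomialMoment, weightCoeff, Fin.sum_univ_five]
  interval_cases r
  · refine (isBigO_const_natCast_zpow 1 le_rfl).congr_left fun n => ?_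
    simp [bTilde, dTilde, eTilde]
    ring
  · refine (isBigO_const_natCast_zpow (6 * x - 1) le_rfl).congr_left fun n => ?_
    simp [bTilde, dTilde, eTilde]
    ring
  · refine (isBigO_linear (x ^ 2 - x) (17 * x ^ 2 - 8 * x + 1)).congr_left fun n => ?_
    simp [bTilde, dTilde, eTilde, Nat.choose]
    ring
  · refine (isBigO_linear (6 * x ^ 3 - 8 * x ^ 2 + 2 * x)
      (32 * x ^ 3 - 31 * x ^ 2 + 10 * x - 1)).congr_left fun n => ?_
    simp [bTilde, dTilde, Nat.choose]
    ring
  · simpa [Nat.choose] using isBigO_bTilde (1 - x)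

theorem sum_weightCoeff_tilde_mul_shiftedMoment_of_lt_four {s : ℕ} (hs : s < 4) (n : ℕ) (x : ℝ) :
    ∑ j : Fin 5, weightCoeff bTilde dTilde eTilde n x j * (shiftedMoment n 4 j s).eval x
      = 0 ^ s := by
  interval_cases s <;>
    simp [Fin.sum_univ_five, weightCoeff, shiftedMoment, bTilde, dTilde, eTilde] <;>
    ring

theorem sum_weightCoeff_tilde_mul_shiftedMoment_four (n : ℕ) (x : ℝ) :
    ∑ j : Fin 5, weightCoeff bTilde dTilde eTilde n x j * (shiftedMoment n 4 j 4).eval x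
      = (-420 * x ^ 4 + 840 * x ^ 3 - 520 * x ^ 2 + 100 * x) * n
        + (-1152 * x ^ 4 + 2304 * x ^ 3 - 1592 * x ^ 2 + 440 * x - 40) := by
  simp [Fin.sum_univ_five, weightCoeff, shiftedMoment, bTilde, dTilde, eTilde]
  ring

theorem isBigO_sum_weightCoeff_tilde_mul_shiftedMoment_sub (s : ℕ) (x : ℝ) :
    (fun n : ℕ => ∑ j : Fin 5, weightCoeff bTilde dTilde eTilde n x j *
      (shiftedMoment n 4 j s).eval x - 0 ^ s) =O[atTop] fun n => (n : ℝ) ^ ((s : ℤ) - 3) := by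
  rcases lt_trichotomy s 4 with hs | rfl | hs
  · simpa only [sum_weightCoeff_tilde_mul_shiftedMoment_of_lt_four hs, sub_self] using
      isBigO_zero _ _
  · simp only [sum_weightCoeff_tilde_mul_shiftedMoment_four, zero_pow four_ne_zero, sub_zero]
    exact isBigO_linear _ _
  · simpa only [zero_pow (by lia : s ≠ 0), sub_zero] using isBigO_sum_mul_shiftedMoment
      (fun r hr => isBigO_binomialMoment_weightCoeff_tilde x hr) 4 (d := (s : ℤ) - 3) (by lia) x

end TildeCoefficients

section Polynomials

theorem isBigO_durrmeyerTilde3_pow_sub (s : ℕ) (x : ℝ) :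
    (fun n => durrmeyerTilde3 n (fun t => (t - x) ^ s) x - 0 ^ s)
      =O[atTop] fun n => (n : ℝ) ^ (-3 : ℤ) := by
  have hprod := isBigO_natCast_zpow_mul (isBigO_inv_ascFactorial 2 s)
    (isBigO_sum_weightCoeff_tilde_mul_shiftedMoment_sub s x)
  rw [show -(s : ℤ) + (s - 3) = -3 by ring] at hprod
  refine hprod.congr' ?_ .rfl
  filter_upwards [eventually_ge_atTop 4] with n hn
  have hzero : ((n + 2).ascFactorial s : ℝ)⁻¹ * 0 ^ s = 0 ^ s := by
    rcases s with _ | s <;> simp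
  rw [durrmeyerTilde3, durrmeyer3_pow bTilde dTilde eTilde hn, mul_sub, hzero]

theorem isBigO_durrmeyerTilde3_eval_sub (P : ℝ[X]) (x : ℝ) :
    (fun n => durrmeyerTilde3 n (fun t => P.eval t) x - P.eval x)
      =O[atTop] fun n => (n : ℝ) ^ (-3 : ℤ) := by
  set a := (taylor x P).coeff
  set S := Finset.range ((taylor x P).natDegree + 1)
  have hP (t : ℝ) : P.eval t = ∑ s ∈ S, a s * (t - x) ^ s := by
    rw [← taylor_eval_sub x P t, eval_eq_sum_range]
  have hint (s : ℕ) : IntervalIntegrable (fun t : ℝ => (t - x) ^ s) volume 0 1 :=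
    Continuous.intervalIntegrable (by fun_prop) _ _
  simp only [hP, durrmeyerTilde3, durrmeyer3_sum_mul bTilde dTilde eTilde _ S a (fun s _ => hint s),
    sub_self, ← Finset.sum_sub_distrib, ← mul_sub]
  exact IsBigO.fun_sum fun s _ => (isBigO_durrmeyerTilde3_pow_sub s x).const_mul_left (a s)

end Polynomials

section Taylor

theorem exists_polynomial_sub_isLittleO {f : ℝ → ℝ} {s : Set ℝ} (hs : Convex ℝ s) {x : ℝ}
    (hx : x ∈ s) {n : ℕ} (hf : ContDiffWithinAt ℝ n f s x) :
    ∃ P : ℝ[X], (fun t => f t - P.eval t) =o[𝓝[s] x] fun t => (t - x) ^ n := by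
  obtain ⟨u, hu_open, hxu, hfu⟩ := hf.contDiffOn' le_rfl (by simp)
  rw [Set.insert_eq_of_mem hx] at hfu
  obtain ⟨ε, hε, hball⟩ := Metric.isOpen_iff.mp hu_open x hxu
  have htaylor := taylor_isLittleO (hs.inter (convex_ball x ε)) ⟨hx, Metric.mem_ball_self hε⟩
    (hfu.mono (Set.inter_subset_inter_right s hball))
  rw [nhdsWithin_inter_of_mem' (mem_nhdsWithin_of_mem_nhds (Metric.ball_mem_nhds x hε))] at htaylor
  refine ⟨∑ k ∈ Finset.range (n + 1), C ((k.factorial : ℝ)⁻¹ *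
    iteratedDerivWithin k f (s ∩ Metric.ball x ε) x) * (X - C x) ^ k, ?_⟩
  simpa only [taylor_within_apply, eval_finsetSum, eval_mul, eval_pow, eval_sub, eval_X, eval_C,
    smul_eq_mul, mul_right_comm] using htaylor

theorem exists_abs_le_mul_pow_of_isBigO {R : ℝ → ℝ} {s : Set ℝ} {x M : ℝ} {i : ℕ}
    (hM : ∀ t ∈ s, |R t| ≤ M) (hR : R =O[𝓝[s] x] fun t => (t - x) ^ (2 * i)) :
    ∃ K, ∀ t ∈ s, |R t| ≤ K * (t - x) ^ (2 * i) := by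
  obtain ⟨c, hc⟩ := hR.bound
  obtain ⟨ε, hε, hball⟩ := Metric.mem_nhdsWithin_iff.mp hc
  have hnonneg (t : ℝ) : 0 ≤ (t - x) ^ (2 * i) := (even_two_mul i).pow_nonneg _
  refine ⟨max c (M / ε ^ (2 * i)), fun t ht => ?_⟩
  rcases lt_or_ge |t - x| ε with hnear | hfar
  · have hbound : |R t| ≤ c * |(t - x) ^ (2 * i)| := hball ⟨hnear, ht⟩
    rw [abs_of_nonneg (hnonneg t)] at hbound
    exact hbound.trans (mul_le_mul_of_nonneg_right (le_max_left _ _) (hnonneg t))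
  · have hM_nonneg : 0 ≤ M := (abs_nonneg _).trans (hM t ht)
    calc |R t| ≤ M / ε ^ (2 * i) * ε ^ (2 * i) := by
          rw [div_mul_cancel₀ _ (pow_pos hε _).ne']
          exact hM t ht
      _ ≤ M / ε ^ (2 * i) * (t - x) ^ (2 * i) := by
          rw [← (even_two_mul i).pow_abs (t - x)]
          gcongr
      _ ≤ max c (M / ε ^ (2 * i)) * (t - x) ^ (2 * i) :=
          mul_le_mul_of_nonneg_right (le_max_right _ _) (hnonneg t)

theorem isBigO_durrmeyerTilde3_sub_of_isBigO_sub_eval {f : ℝ → ℝ} {x M : ℝ}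
    (hx : x ∈ Set.Icc (0 : ℝ) 1) (hf : IntervalIntegrable f volume 0 1)
    (hM : ∀ t ∈ Set.Icc (0 : ℝ) 1, |f t| ≤ M) {P : ℝ[X]}
    (hP : (fun t => f t - P.eval t) =O[𝓝[Set.Icc 0 1] x] fun t => (t - x) ^ 10) :
    (fun n => durrmeyerTilde3 n f x - f x) =O[atTop] fun n => (n : ℝ) ^ (-3 : ℤ) := by
  obtain ⟨M', hM'⟩ := isCompact_Icc.exists_bound_of_continuousOn P.continuous.continuousOn
  obtain ⟨K, hK⟩ := exists_abs_le_mul_pow_of_isBigO (i := 5)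
    (fun t ht => (abs_sub _ _).trans (add_le_add (hM t ht) (hM' t ht))) hP
  have hPx : f x = P.eval x := by simpa [sub_eq_zero] using hK x hx
  have hremainder := isBigO_durrmeyer3_of_abs_le bTilde dTilde eTilde hx
    (isBigO_weightCoeff_tilde x) hK
  refine (hremainder.add (isBigO_durrmeyerTilde3_eval_sub P x)).congr_left fun n => ?_
  rw [durrmeyer3_sub bTilde dTilde eTilde n hf (P.continuous.intervalIntegrable _ _), hPx,
    durrmeyerTilde3, durrmeyerTilde3]
  ring

end Taylor

end DurrmeyerIII

theorem mainTheorem3_general {f : ℝ → ℝ} {x M : ℝ} (hx : x ∈ Set.Icc (0 : ℝ) 1)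
    (hf_int : IntervalIntegrable f MeasureTheory.volume 0 1)
    (hf_bdd : ∀ t ∈ Set.Icc (0 : ℝ) 1, |f t| ≤ M)
    (hf : ContDiffWithinAt ℝ 10 f (Set.Icc 0 1) x) :
    (fun n : ℕ => DurrmeyerIII.durrmeyerTilde3 n f x - f x)
      =O[atTop] (fun n : ℕ => 1 / (n : ℝ) ^ 3) := by
  obtain ⟨P, hP⟩ := DurrmeyerIII.exists_polynomial_sub_isLittleO (n := 10) (convex_Icc 0 1) hx
    (by exact_mod_cast hf)
  refine (DurrmeyerIII.isBigO_durrmeyerTilde3_sub_of_isBigO_sub_eval hx hf_int hf_bdd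
    hP.isBigO).congr_right fun n => ?_
  rw [zpow_neg, one_div]
  norm_cast

theorem mainTheorem3 (f : ℝ → ℝ) (hf : ContDiffOn ℝ 10 f (Set.Icc 0 1))
    (x : ℝ) (hx : x ∈ Set.Icc (0 : ℝ) 1) :
    (fun n : ℕ => DurrmeyerIII.durrmeyerTilde3 n f x - f x)
      =O[atTop] (fun n : ℕ => 1 / (n : ℝ) ^ 3) := by
  obtain ⟨M, hM⟩ := isCompact_Icc.exists_bound_of_continuousOn hf.continuousOn
  exact mainTheorem3_general hx (hf.continuousOn.intervalIntegrable_of_Icc zero_le_one) hM (hf x hx)
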